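/- For a finite abelian group $G$, let $Cl(\mathbb{Z}[G])$ be the locally free class group, i.e. the group of stable isomorphism classes of finitely generated locally free $\mathbb{Z}[G]$-modules under direct sum, where $M$ and $N$ are stably isomorphic if $M\oplus\mathbb{Z}[G]^a\cong N\oplus\mathbb{Z}[G]^b$ for some $a,b\ge 0$. Let $\mathcal{M}$ be the maximal order of $\mathbb{Q}[G]$ (the integral closure of $\mathbb{Z}$ in $\mathbb{Q}[G]$), and let the kernel group $D(\mathbb{Z}[G])$ be the subgroup of those classes in $Cl(\mathbb{Z}[G])$ that become trivial in $Cl(\mathcal{M})$ under extension of scalars $M\mapsto\mathcal{M}\otimes_{\mathbb{Z}[G]}M$. Corollary 2.2 (Rim's Theorem). For each odd prime $p$ and each group $G\cong C_p$, where $C_p$ is the cyclic group of order $p$, the kernel group $D(\mathbb{Z}[G])$ is trivial. -/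

import Mathlib

open scoped TensorProduct

universe u

/-! ### Locally free modules -/

/-- The multiplicative set of a commutative ring `Λ` at which one localizes to form
`Λ_P = ℤ_P ⊗ Λ`, for a prime ideal `P` of `ℤ`: the image of `ℤ ∖ P` in `Λ`. -/
def primeComplImage (Λ : Type u) [CommRing Λ] (P : Ideal ℤ) [P.IsPrime] : Submonoid Λ :=
  P.primeCompl.map (Int.castRingHom Λ)

/-- A module `M` over a commutative `ℤ`-order `Λ` is locally free if it is finitely generated
and there is a natural number `n` (its rank) such that for every prime `P` of `ℤ` the
localization `M_P` is a free `Λ_P`-module of rank `n`. (Including `P = 0` changes nothing: that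
case follows from the nonzero primes.) -/
structure IsLocallyFree (Λ : Type u) [CommRing Λ] (M : Type u) [AddCommGroup M] [Module Λ M] :
    Prop where
  finite : Module.Finite Λ M
  exists_rank : ∃ n : ℕ, ∀ (P : Ideal ℤ) [P.IsPrime],
    Nonempty (LocalizedModule (primeComplImage Λ P) M ≃ₗ[Localization (primeComplImage Λ P)]
      (Fin n → Localization (primeComplImage Λ P)))

/-- Bundled locally free `Λ`-modules. -/
structure LocallyFreeModule (Λ : Type u) [CommRing Λ] : Type (u + 1) where
  carrier : Type u
  [addCommGroup : AddCommGroup carrier]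
  [module : Module Λ carrier]
  isLocallyFree : IsLocallyFree Λ carrier

attribute [instance] LocallyFreeModule.addCommGroup LocallyFreeModule.module

section Stability

variable {Λ : Type u} [CommRing Λ]

theorem nonempty_localized_equiv_iff (S : Submonoid Λ) (M : Type u) [AddCommGroup M] [Module Λ M]
    (n : ℕ) :
    Nonempty (LocalizedModule S M ≃ₗ[Localization S] (Fin n → Localization S)) ↔
      Nonempty (Localization S ⊗[Λ] M ≃ₗ[Localization S] (Fin n → Localization S)) :=
  ⟨fun ⟨e⟩ => ⟨(LocalizedModule.equivTensorProduct S M).symm ≪≫ₗ e⟩,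
    fun ⟨e⟩ => ⟨(LocalizedModule.equivTensorProduct S M) ≪≫ₗ e⟩⟩

/-- `Aᵐ × Aⁿ ≅ Aᵐ⁺ⁿ`. -/
def finProdEquiv (A : Type*) [Semiring A] (m n : ℕ) :
    ((Fin m → A) × (Fin n → A)) ≃ₗ[A] (Fin (m + n) → A) :=
  (LinearEquiv.sumArrowLequivProdArrow (Fin m) (Fin n) A A).symm ≪≫ₗ
    LinearEquiv.funCongrLeft A A finSumFinEquiv.symm

theorem IsLocallyFree.of_equiv {M N : Type u} [AddCommGroup M] [Module Λ M] [AddCommGroup N]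
    [Module Λ N] (e : M ≃ₗ[Λ] N) (h : IsLocallyFree Λ M) : IsLocallyFree Λ N := by
  obtain ⟨hf, n, hn⟩ := h
  refine ⟨Module.Finite.equiv e, n, fun P _ => ?_⟩
  rw [nonempty_localized_equiv_iff]
  obtain ⟨f⟩ := (nonempty_localized_equiv_iff _ _ _).1 (hn P)
  exact ⟨(e.baseChange Λ (Localization (primeComplImage Λ P)) M N).symm ≪≫ₗ f⟩

theorem IsLocallyFree.pi (n : ℕ) : IsLocallyFree Λ (Fin n → Λ) := by
  refine ⟨inferInstance, n, fun P _ => ?_⟩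
  rw [nonempty_localized_equiv_iff]
  exact ⟨TensorProduct.piScalarRight Λ _ _ (Fin n)⟩

theorem IsLocallyFree.prod {M N : Type u} [AddCommGroup M] [Module Λ M] [AddCommGroup N]
    [Module Λ N] (hM : IsLocallyFree Λ M) (hN : IsLocallyFree Λ N) : IsLocallyFree Λ (M × N) := by
  obtain ⟨hMf, m, hm⟩ := hM
  obtain ⟨hNf, n, hn⟩ := hN
  refine ⟨inferInstance, m + n, fun P _ => ?_⟩
  rw [nonempty_localized_equiv_iff]
  obtain ⟨f⟩ := (nonempty_localized_equiv_iff _ _ _).1 (hm P)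
  obtain ⟨g⟩ := (nonempty_localized_equiv_iff _ _ _).1 (hn P)
  exact ⟨TensorProduct.prodRight Λ (Localization (primeComplImage Λ P)) _ M N ≪≫ₗ
    f.prodCongr g ≪≫ₗ finProdEquiv _ m n⟩

theorem IsLocallyFree.projective [IsNoetherianRing Λ] {M : Type u} [AddCommGroup M] [Module Λ M]
    (h : IsLocallyFree Λ M) : Module.Projective Λ M := by
  obtain ⟨hf, n, hn⟩ := h
  have : Module.FinitePresentation Λ M := Module.finitePresentation_of_finite Λ M
  refine Module.projective_of_localization_maximal fun I hI => ?_
  have : (I.comap (Int.castRingHom Λ)).IsPrime := Ideal.IsPrime.comap _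
  obtain ⟨f⟩ := (nonempty_localized_equiv_iff _ _ _).1 (hn (I.comap (Int.castRingHom Λ)))
  set S := primeComplImage Λ (I.comap (Int.castRingHom Λ)) with hS
  have hle : S ≤ I.primeCompl := by
    rintro _ ⟨x, hx, rfl⟩
    exact hx
  let _ := IsLocalization.localizationAlgebraOfSubmonoidLe (Localization S)
    (Localization.AtPrime I) S I.primeCompl hle
  have := IsLocalization.localization_isScalarTower_of_submonoid_le (Localization S)
    (Localization.AtPrime I) S I.primeCompl hle
  let e : LocalizedModule I.primeCompl M ≃ₗ[Localization.AtPrime I]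
      Localization.AtPrime I ⊗[Localization S] (Fin n → Localization S) :=
    LocalizedModule.equivTensorProduct I.primeCompl M ≪≫ₗ
      (TensorProduct.AlgebraTensorModule.cancelBaseChange Λ (Localization S)
        (Localization.AtPrime I) (Localization.AtPrime I) M).symm ≪≫ₗ
      f.baseChange (Localization S) (Localization.AtPrime I) _ _
  exact Module.Projective.of_equiv e.symm

theorem IsLocallyFree.exists_complement [IsNoetherianRing Λ] {M : Type u} [AddCommGroup M]
    [Module Λ M] (h : IsLocallyFree Λ M) :
    ∃ (N : LocallyFreeModule Λ) (k : ℕ), Nonempty ((M × N.carrier) ≃ₗ[Λ] (Fin k → Λ)) := by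
  have hproj := h.projective
  obtain ⟨hf, m, hm⟩ := h
  obtain ⟨k, g, hg⟩ := Module.Finite.exists_fin' Λ M
  obtain ⟨s, hs⟩ := Module.projective_lifting_property g LinearMap.id hg
  have e₀ : Nonempty ((M × LinearMap.ker g) ≃ₗ[Λ] (Fin k → Λ)) := by
    have hs' : ∀ x, g (s x) = x := LinearMap.congr_fun hs
    refine ⟨LinearEquiv.ofLinearMap (s.coprod (LinearMap.ker g).subtype)
      (g.prod (LinearMap.codRestrict (LinearMap.ker g) (LinearMap.id - s ∘ₗ g) ?_)) ?_ ?_⟩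
    · intro v
      simp [hs']
    · ext1 v
      simp
    · refine LinearMap.ext fun ⟨x, z⟩ => Prod.ext ?_ (Subtype.ext ?_)
      · simp [hs']
      · simp [hs']
  obtain ⟨e⟩ := e₀
  let N := LinearMap.ker g × (Fin m → Λ)
  have hN : IsLocallyFree Λ N := by
    refine ⟨inferInstance, k, fun P _ => ?_⟩
    obtain ⟨f⟩ := (nonempty_localized_equiv_iff _ _ _).1 (hm P)
    rw [nonempty_localized_equiv_iff]
    let L := Localization (primeComplImage Λ P)
    exact ⟨TensorProduct.prodRight Λ L L _ _ ≪≫ₗ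
      (LinearEquiv.refl L _).prodCongr (TensorProduct.piScalarRight Λ L L (Fin m) ≪≫ₗ f.symm) ≪≫ₗ
      (TensorProduct.prodRight Λ L L _ _).symm ≪≫ₗ
      (LinearEquiv.prodComm Λ _ _ ≪≫ₗ e).baseChange Λ L _ _ ≪≫ₗ
      TensorProduct.piScalarRight Λ L L (Fin k)⟩
  exact ⟨⟨N, hN⟩, k + m, ⟨(LinearEquiv.prodAssoc Λ M (LinearMap.ker g) (Fin m → Λ)).symm ≪≫ₗ
    e.prodCongr (LinearEquiv.refl Λ _) ≪≫ₗ finProdEquiv Λ k m⟩⟩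

theorem IsLocallyFree.baseChange (Γ : Type u) [CommRing Γ] [Algebra Λ Γ] {M : Type u}
    [AddCommGroup M] [Module Λ M] (h : IsLocallyFree Λ M) : IsLocallyFree Γ (Γ ⊗[Λ] M) := by
  obtain ⟨hf, n, hn⟩ := h
  refine ⟨inferInstance, n, fun P _ => ?_⟩
  obtain ⟨f⟩ := (nonempty_localized_equiv_iff _ _ _).1 (hn P)
  rw [nonempty_localized_equiv_iff]
  let A := Localization (primeComplImage Λ P)
  let B := Localization (primeComplImage Γ P)
  have hle : primeComplImage Λ P ≤ (primeComplImage Γ P).comap (algebraMap Λ Γ) := by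
    rintro _ ⟨x, hx, rfl⟩
    exact ⟨x, hx, by simp⟩
  let _ : Algebra A B := (IsLocalization.map B (algebraMap Λ Γ) hle : A →+* B).toAlgebra
  have : IsScalarTower Λ A B := IsScalarTower.of_algebraMap_eq fun x => by
    rw [RingHom.algebraMap_toAlgebra, IsLocalization.map_eq, ← IsScalarTower.algebraMap_apply]
  exact ⟨TensorProduct.AlgebraTensorModule.cancelBaseChange Λ Γ B B M ≪≫ₗ
    (TensorProduct.AlgebraTensorModule.cancelBaseChange Λ A B B M).symm ≪≫ₗ
    f.baseChange A B _ _ ≪≫ₗ TensorProduct.piScalarRight A B B (Fin n)⟩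

end Stability

namespace LocallyFreeModule

variable {Λ : Type u} [CommRing Λ]

/-- Two locally free modules are stably isomorphic if they become isomorphic after adding free
modules of finite rank. (Different ranks are allowed, so that every free module is stably trivial
and the stable isomorphism classes form a group.) -/
def StablyIso (M N : LocallyFreeModule Λ) : Prop :=
  ∃ a b : ℕ, Nonempty ((M.carrier × (Fin a → Λ)) ≃ₗ[Λ] (N.carrier × (Fin b → Λ)))

/-- The direct sum of locally free modules. -/
def sum (M N : LocallyFreeModule Λ) : LocallyFreeModule Λ :=
  ⟨M.carrier × N.carrier, M.isLocallyFree.prod N.isLocallyFree⟩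

/-- The free module `Λⁿ`. -/
def free (Λ : Type u) [CommRing Λ] (n : ℕ) : LocallyFreeModule Λ :=
  ⟨Fin n → Λ, IsLocallyFree.pi n⟩

/-- Extension of scalars of a locally free module. -/
noncomputable def baseChange (Γ : Type u) [CommRing Γ] [Algebra Λ Γ] (M : LocallyFreeModule Λ) :
    LocallyFreeModule Γ :=
  ⟨Γ ⊗[Λ] M.carrier, M.isLocallyFree.baseChange Γ⟩

theorem StablyIso.of_equiv {M N : LocallyFreeModule Λ} (e : M.carrier ≃ₗ[Λ] N.carrier) :
    StablyIso M N :=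
  ⟨0, 0, ⟨e.prodCongr (LinearEquiv.refl Λ _)⟩⟩

theorem StablyIso.refl (M : LocallyFreeModule Λ) : StablyIso M M :=
  .of_equiv (LinearEquiv.refl Λ _)

theorem StablyIso.symm {M N : LocallyFreeModule Λ} : StablyIso M N → StablyIso N M :=
  fun ⟨a, b, ⟨e⟩⟩ => ⟨b, a, ⟨e.symm⟩⟩

theorem StablyIso.trans {M N P : LocallyFreeModule Λ} :
    StablyIso M N → StablyIso N P → StablyIso M P := by
  rintro ⟨a, b, ⟨e⟩⟩ ⟨c, d, ⟨f⟩⟩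
  refine ⟨a + c, d + b, ⟨?_⟩⟩
  exact (LinearEquiv.refl Λ _).prodCongr (finProdEquiv Λ a c).symm ≪≫ₗ
    (LinearEquiv.prodAssoc Λ _ _ _).symm ≪≫ₗ e.prodCongr (LinearEquiv.refl Λ _) ≪≫ₗ
    LinearEquiv.prodAssoc Λ _ _ _ ≪≫ₗ
    (LinearEquiv.refl Λ _).prodCongr (LinearEquiv.prodComm Λ _ _) ≪≫ₗ
    (LinearEquiv.prodAssoc Λ _ _ _).symm ≪≫ₗ f.prodCongr (LinearEquiv.refl Λ _) ≪≫ₗ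
    LinearEquiv.prodAssoc Λ _ _ _ ≪≫ₗ (LinearEquiv.refl Λ _).prodCongr (finProdEquiv Λ d b)

theorem StablyIso.sum {M M' N N' : LocallyFreeModule Λ} :
    StablyIso M M' → StablyIso N N' → StablyIso (M.sum N) (M'.sum N') := by
  rintro ⟨a, b, ⟨e⟩⟩ ⟨c, d, ⟨f⟩⟩
  refine ⟨a + c, b + d, ⟨?_⟩⟩
  exact (LinearEquiv.refl Λ _).prodCongr (finProdEquiv Λ a c).symm ≪≫ₗ
    LinearEquiv.prodProdProdComm Λ _ _ _ _ ≪≫ₗ e.prodCongr f ≪≫ₗ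
    LinearEquiv.prodProdProdComm Λ _ _ _ _ ≪≫ₗ
    (LinearEquiv.refl Λ _).prodCongr (finProdEquiv Λ b d)

theorem StablyIso.free_free (m n : ℕ) : StablyIso (free Λ m) (free Λ n) :=
  ⟨n, m, ⟨LinearEquiv.prodComm Λ _ _⟩⟩

theorem StablyIso.baseChange (Γ : Type u) [CommRing Γ] [Algebra Λ Γ] {M N : LocallyFreeModule Λ} :
    StablyIso M N → StablyIso (M.baseChange Γ) (N.baseChange Γ) := by
  rintro ⟨a, b, ⟨e⟩⟩
  refine ⟨a, b, ⟨?_⟩⟩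
  exact (LinearEquiv.refl Γ _).prodCongr (TensorProduct.piScalarRight Λ Γ Γ (Fin a)).symm ≪≫ₗ
    (TensorProduct.prodRight Λ Γ Γ _ _).symm ≪≫ₗ e.baseChange Λ Γ _ _ ≪≫ₗ
    TensorProduct.prodRight Λ Γ Γ _ _ ≪≫ₗ
    (LinearEquiv.refl Γ _).prodCongr (TensorProduct.piScalarRight Λ Γ Γ (Fin b))

/-- Stable isomorphism as an equivalence relation. -/
def stableSetoid (Λ : Type u) [CommRing Λ] : Setoid (LocallyFreeModule Λ) where
  r := StablyIso
  iseqv := ⟨StablyIso.refl, StablyIso.symm, StablyIso.trans⟩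

end LocallyFreeModule

/-! ### The locally free class group -/

/-- The locally free class group `Cl(Λ)` of a commutative `ℤ`-order `Λ`: the stable isomorphism
classes of locally free `Λ`-modules, with the addition induced by the direct sum
(written additively). -/
def LocallyFreeClassGroup (Λ : Type u) [CommRing Λ] : Type (u + 1) :=
  Quotient (LocallyFreeModule.stableSetoid Λ)

namespace LocallyFreeClassGroup

open LocallyFreeModule

variable {Λ : Type u} [CommRing Λ]

/-- The class of a locally free module. -/
def mk (M : LocallyFreeModule Λ) : LocallyFreeClassGroup Λ :=
  Quotient.mk (stableSetoid Λ) M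

theorem mk_eq_mk_iff {M N : LocallyFreeModule Λ} : mk M = mk N ↔ StablyIso M N :=
  Quotient.eq (r := stableSetoid Λ)

instance : Zero (LocallyFreeClassGroup Λ) := ⟨mk (free Λ 0)⟩

instance : Add (LocallyFreeClassGroup Λ) :=
  ⟨Quotient.map₂ LocallyFreeModule.sum fun _ _ h _ _ h' => h.sum h'⟩

theorem zero_def : (0 : LocallyFreeClassGroup Λ) = mk (free Λ 0) := rfl

theorem mk_add_mk (M N : LocallyFreeModule Λ) : mk M + mk N = mk (M.sum N) := rfl

theorem exists_add_eq_zero [IsNoetherianRing Λ] (x : LocallyFreeClassGroup Λ) :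
    ∃ y, x + y = 0 := by
  induction x using Quotient.inductionOn with
  | _ M =>
    obtain ⟨N, k, ⟨e⟩⟩ := M.isLocallyFree.exists_complement
    have h : StablyIso (M.sum N) (free Λ k) := .of_equiv e
    exact ⟨mk N, mk_eq_mk_iff.2 (h.trans (.free_free k 0))⟩

noncomputable instance [IsNoetherianRing Λ] : Neg (LocallyFreeClassGroup Λ) :=
  ⟨fun x => (exists_add_eq_zero x).choose⟩

instance : AddCommMonoid (LocallyFreeClassGroup Λ) where
  add_assoc x y z := by
    induction x using Quotient.inductionOn
    induction y using Quotient.inductionOn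
    induction z using Quotient.inductionOn
    exact mk_eq_mk_iff.2 (.of_equiv (LinearEquiv.prodAssoc Λ _ _ _))
  add_comm x y := by
    induction x using Quotient.inductionOn
    induction y using Quotient.inductionOn
    exact mk_eq_mk_iff.2 (.of_equiv (LinearEquiv.prodComm Λ _ _))
  zero_add x := by
    induction x using Quotient.inductionOn with
    | _ M =>
      have h : StablyIso ((free Λ 0).sum M) M :=
        .of_equiv (LinearEquiv.uniqueProd (M := M.carrier) (M₂ := Fin 0 → Λ))
      exact mk_eq_mk_iff.2 h
  add_zero x := by
    induction x using Quotient.inductionOn with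
    | _ M =>
      have h : StablyIso (M.sum (free Λ 0)) M :=
        .of_equiv (LinearEquiv.prodUnique (M := M.carrier) (M₂ := Fin 0 → Λ))
      exact mk_eq_mk_iff.2 h
  nsmul := nsmulRec

noncomputable instance [IsNoetherianRing Λ] : AddCommGroup (LocallyFreeClassGroup Λ) where
  __ := (inferInstance : AddCommMonoid (LocallyFreeClassGroup Λ))
  zsmul := zsmulRec
  neg_add_cancel x := by
    rw [add_comm]
    exact (exists_add_eq_zero x).choose_spec

/-- Extension of scalars `Cl(Λ) → Cl(Γ)`, `[M] ↦ [Γ ⊗ M]`. -/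
noncomputable def extendScalars (Λ Γ : Type u) [CommRing Λ] [CommRing Γ] [Algebra Λ Γ] :
    LocallyFreeClassGroup Λ →+ LocallyFreeClassGroup Γ where
  toFun := Quotient.map (LocallyFreeModule.baseChange Γ) fun _ _ h => h.baseChange Γ
  map_zero' := by
    have h : StablyIso ((free Λ 0).baseChange Γ) (free Γ 0) :=
      .of_equiv (TensorProduct.piScalarRight Λ Γ Γ (Fin 0))
    exact mk_eq_mk_iff.2 h
  map_add' x y := by
    induction x using Quotient.inductionOn
    induction y using Quotient.inductionOn
    exact mk_eq_mk_iff.2 (.of_equiv (TensorProduct.prodRight Λ Γ Γ _ _))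

theorem extendScalars_mk (Γ : Type u) [CommRing Γ] [Algebra Λ Γ] (M : LocallyFreeModule Λ) :
    extendScalars Λ Γ (mk M) = mk (M.baseChange Γ) := rfl

end LocallyFreeClassGroup

/-! ### The maximal order of `ℚ[G]` and the kernel group -/

/-- A `ℤ`-order in a `ℚ`-algebra `A`: a subring that is finitely generated as a `ℤ`-module and
spans `A` over `ℚ`. -/
structure IsIntOrder {A : Type*} [CommRing A] [Algebra ℚ A] (Γ : Subalgebra ℤ A) : Prop where
  finite : Module.Finite ℤ Γ
  span_eq_top : Submodule.span ℚ (Γ : Set A) = ⊤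

/-- The maximal order of `ℚ[G]` for a finite abelian group `G`, realized as the integral closure
of `ℤ` in `ℚ[G]`. -/
noncomputable def maximalOrder (G : Type u) [CommGroup G] : Subalgebra ℤ (MonoidAlgebra ℚ G) :=
  integralClosure ℤ (MonoidAlgebra ℚ G)

section MaximalOrder

variable (G : Type u) [CommGroup G]

/-- Traces of integral elements are integers. -/
theorem exists_int_trace_eq {A : Type*} [CommRing A] [Algebra ℚ A] {ι : Type*} [Fintype ι]
    [DecidableEq ι] (b : Module.Basis ι ℚ A) {x : A} (hx : IsIntegral ℤ x) :
    ∃ m : ℤ, (m : ℚ) = (Algebra.leftMulMatrix b x).trace := by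
  let K := AlgebraicClosure ℚ
  let M : Matrix ι ι K := (Algebra.leftMulMatrix b x).map (algebraMap ℚ K)
  obtain ⟨q, hq, hqx⟩ := hx
  have hqM : Polynomial.aeval M q = 0 := by
    let f : A →+* Matrix ι ι K :=
      (algebraMap ℚ K).mapMatrix.comp (Algebra.leftMulMatrix b).toRingHom
    have h : f (Polynomial.eval₂ (algebraMap ℤ A) x q) = 0 := by rw [hqx, map_zero]
    rw [Polynomial.hom_eval₂] at h
    rw [Polynomial.aeval_def, ← h]
    congr 1
    exact RingHom.ext_int _ _
  have htr : IsIntegral ℤ M.trace := by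
    rw [Matrix.trace_eq_sum_roots_charpoly]
    refine IsIntegral.multiset_sum fun μ hμ => ?_
    have hμ' : μ ∈ spectrum K M :=
      Matrix.mem_spectrum_iff_isRoot_charpoly.2 (Polynomial.isRoot_of_mem_roots hμ)
    refine ⟨q, hq, ?_⟩
    have h := spectrum.subset_polynomial_aeval M (q.map (algebraMap ℤ K))
      (Set.mem_image_of_mem _ hμ')
    rw [Polynomial.aeval_map_algebraMap, hqM] at h
    simp only [Polynomial.eval_map] at h
    by_contra hne
    exact (spectrum.mem_iff.1 h) (by simpa using (Ne.isUnit hne).map (algebraMap K _))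
  have htr' : IsIntegral ℤ (Algebra.leftMulMatrix b x).trace := by
    have : M.trace = algebraMap ℚ K (Algebra.leftMulMatrix b x).trace := by
      simp [M, Matrix.trace]
    rw [this] at htr
    exact (isIntegral_algebraMap_iff (algebraMap ℚ K).injective).1 htr
  exact IsIntegrallyClosed.isIntegral_iff.1 htr'

/-- `|G|` times a coefficient of an integral element of `ℚ[G]` is an integer. -/
theorem exists_int_card_mul_coeff [Finite G] {x : MonoidAlgebra ℚ G} (hx : x ∈ maximalOrder G)
    (g : G) : ∃ m : ℤ, (m : ℚ) = Nat.card G * x.coeff g := by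
  classical
  have := Fintype.ofFinite G
  let b : Module.Basis G ℚ (MonoidAlgebra ℚ G) := ⟨MonoidAlgebra.coeffLinearEquiv ℚ⟩
  have hb : ∀ h, b h = MonoidAlgebra.single h 1 := fun h => rfl
  have hg : IsIntegral ℤ (MonoidAlgebra.single g⁻¹ (1 : ℚ)) := by
    refine IsIntegral.of_pow (n := Nat.card G) Nat.card_pos ?_
    rw [MonoidAlgebra.single_pow, pow_card_eq_one', one_pow]
    exact isIntegral_one
  obtain ⟨m, hm⟩ := exists_int_trace_eq b (IsIntegral.mul hx hg)
  refine ⟨m, hm.trans ?_⟩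
  have h : ∀ i, Algebra.leftMulMatrix b (x * MonoidAlgebra.single g⁻¹ 1) i i = x.coeff g := by
    intro i
    rw [Algebra.leftMulMatrix_eq_repr_mul, hb, mul_assoc, MonoidAlgebra.single_mul_single]
    change (x * MonoidAlgebra.single (g⁻¹ * i) (1 * 1)).coeff i = _
    rw [one_mul, MonoidAlgebra.coeff_mul_single_apply]
    simp
  simp only [Matrix.trace, Matrix.diag_apply, h]
  simp

/-- The integral group ring lies in the maximal order. -/
theorem mapRingHom_mem_maximalOrder [Finite G] (x : MonoidAlgebra ℤ G) :
    MonoidAlgebra.mapRingHom G (Int.castRingHom ℚ) x ∈ maximalOrder G := by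
  have hx : IsIntegral ℤ x := IsIntegral.of_finite ℤ x
  exact hx.map (MonoidAlgebra.mapRingHom G (Int.castRingHom ℚ)).toIntAlgHom

instance [Finite G] : Module.Finite ℤ (maximalOrder G) := by
  let N : Submodule ℤ (MonoidAlgebra ℚ G) :=
    LinearMap.range (MonoidAlgebra.mapRingHom G (Int.castRingHom ℚ)).toIntAlgHom.toLinearMap
  have hmem : ∀ x : maximalOrder G, (Nat.card G : ℤ) • (x : MonoidAlgebra ℚ G) ∈ N := by
    intro x
    choose m hm using exists_int_card_mul_coeff G x.2
    refine ⟨MonoidAlgebra.ofCoeff (Finsupp.equivFunOnFinite.symm m), ?_⟩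
    ext g
    rw [MonoidAlgebra.coeff_smul, Finsupp.smul_apply]
    simp [hm]
  let T : maximalOrder G →ₗ[ℤ] N :=
    LinearMap.codRestrict N ((Nat.card G : ℤ) • (maximalOrder G).val.toLinearMap) hmem
  have : IsNoetherian ℤ N := isNoetherian_of_isNoetherianRing_of_finite ℤ N
  refine Module.Finite.of_injective T fun x y hxy => ?_
  have h : (Nat.card G : ℤ) • (x : MonoidAlgebra ℚ G) = (Nat.card G : ℤ) • (y : MonoidAlgebra ℚ G) :=
    congrArg Subtype.val hxy
  refine Subtype.ext ?_
  ext g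
  have h' := congrArg (fun z => z.coeff g) h
  simp only [MonoidAlgebra.coeff_smul, Finsupp.smul_apply] at h'
  simpa [Nat.card_pos.ne'] using h'

instance [Finite G] : IsNoetherianRing (MonoidAlgebra ℤ G) :=
  isNoetherian_of_isNoetherianRing_of_finite ℤ _ |> isNoetherian_of_tower ℤ

instance [Finite G] : IsNoetherianRing (maximalOrder G) :=
  isNoetherian_of_tower ℤ (isNoetherian_of_isNoetherianRing_of_finite ℤ (maximalOrder G))

/-- `maximalOrder G` is an order of `ℚ[G]` and contains every other one. -/
theorem isGreatest_maximalOrder [Finite G] :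
    IsGreatest {Γ : Subalgebra ℤ (MonoidAlgebra ℚ G) | IsIntOrder Γ} (maximalOrder G) := by
  refine ⟨⟨inferInstance, ?_⟩, fun Γ hΓ x hx => ?_⟩
  · rw [eq_top_iff]
    intro x _
    induction x using MonoidAlgebra.induction_linear with
    | zero => exact zero_mem _
    | add f g hf hg => exact add_mem (hf trivial) (hg trivial)
    | single g r =>
      have h := Submodule.smul_mem (Submodule.span ℚ (maximalOrder G : Set (MonoidAlgebra ℚ G))) r
        (Submodule.subset_span (mapRingHom_mem_maximalOrder G (MonoidAlgebra.single g 1)))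
      rw [MonoidAlgebra.mapRingHom_single, map_one, MonoidAlgebra.smul_single, smul_eq_mul,
        mul_one] at h
      exact h
  · have := hΓ.finite
    exact (IsIntegral.of_finite ℤ (⟨x, hx⟩ : Γ)).map Γ.val

/-- The inclusion of `ℤ[G]` into the maximal order of `ℚ[G]`. -/
noncomputable def toMaximalOrder [Finite G] : MonoidAlgebra ℤ G →+* maximalOrder G :=
  (MonoidAlgebra.mapRingHom G (Int.castRingHom ℚ)).codRestrict (maximalOrder G)
    (mapRingHom_mem_maximalOrder G)

noncomputable instance [Finite G] : Algebra (MonoidAlgebra ℤ G) (maximalOrder G) :=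
  (toMaximalOrder G).toAlgebra

/-- The kernel group `D(ℤ[G])` of a finite abelian group `G`: the subgroup of `Cl(ℤ[G])` of those
classes that become trivial upon extension of scalars to the maximal order of `ℚ[G]`. -/
noncomputable def kernelGroup [Finite G] : AddSubgroup (LocallyFreeClassGroup (MonoidAlgebra ℤ G)) :=
  (LocallyFreeClassGroup.extendScalars (MonoidAlgebra ℤ G) (maximalOrder G)).ker

end MaximalOrder

/-! ### Bases modulo an ideal -/

/-! Let `g` generate the group, let `χ` send `g` to a primitive `p`-th root of unity `ζ`, and let
`I` and `J` be the kernels in `ℤ[G]` of `χ` and of the augmentation. Then `I ⊓ J = 0`, the quotients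
are `ℤ[ζ]` and `ℤ`, and the quotient by `I ⊔ J` is `𝔽_p`, so `ℤ[G]` is the fibre product of `ℤ[ζ]`
and `ℤ` over `𝔽_p`. Both quotient maps factor through the maximal order, so a module `M` that
becomes free there has bases modulo `I` and modulo `J` (`exists_isBasisMod`).

Over `𝔽_p` these two bases differ by an invertible matrix, a product of transvections and diagonal
matrices. Transvections always lift to `ℤ[ζ]`; diagonal ones lift because the cyclotomic units `1 +
ζ + ⋯ + ζ ^ (k - 1)` reduce to `k` (`exists_unit_lift`). Correcting the basis modulo `I` by such a
lift makes the two bases glue, so `M` is free (`nonempty_equiv_of_isBasisMod`). The theorem follows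
by applying this to `M ⊕ ℤ[G]^a`. -/

/-- The family `x` of elements of `M` induces a basis of `M / I M` over `Λ / I`. -/
structure IsBasisMod {Λ M ι : Type*} [CommRing Λ] [AddCommGroup M] [Module Λ M] [Fintype ι]
    (I : Ideal Λ) (x : ι → M) : Prop where
  exists_sub_mem : ∀ m, ∃ c : ι → Λ, m - ∑ i, c i • x i ∈ I • (⊤ : Submodule Λ M)
  mem_of_sum_mem : ∀ c : ι → Λ, ∑ i, c i • x i ∈ I • (⊤ : Submodule Λ M) → ∀ i, c i ∈ I

namespace IsBasisMod

variable {Λ M ι : Type*} [CommRing Λ] [AddCommGroup M] [Module Λ M] [Fintype ι]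
  {I J : Ideal Λ} {x y : ι → M}

theorem sum_smul_mem (I : Ideal Λ) {c : ι → Λ} (hc : ∀ i, c i ∈ I) (x : ι → M) :
    ∑ i, c i • x i ∈ I • (⊤ : Submodule Λ M) :=
  sum_mem fun i _ => Submodule.smul_mem_smul (hc i) trivial

theorem congr (hx : IsBasisMod I x) (h : ∀ i, x i - y i ∈ I • (⊤ : Submodule Λ M)) :
    IsBasisMod I y := by
  have key : ∀ c : ι → Λ, ∑ i, c i • x i - ∑ i, c i • y i ∈ I • (⊤ : Submodule Λ M) := by
    intro c
    rw [← Finset.sum_sub_distrib]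
    refine sum_mem fun i _ => ?_
    rw [← smul_sub]
    exact Submodule.smul_mem _ _ (h i)
  refine ⟨fun m => ?_, fun c hc => hx.mem_of_sum_mem c ?_⟩
  · obtain ⟨c, hc⟩ := hx.exists_sub_mem m
    exact ⟨c, by simpa using add_mem hc (key c)⟩
  · simpa using add_mem (key c) hc

/-- A basis modulo `I` is also a basis modulo `I + J`. -/
theorem sup (hx : IsBasisMod I x) (J : Ideal Λ) : IsBasisMod (I ⊔ J) x := by
  refine ⟨fun m => ?_, fun c hc => ?_⟩
  · obtain ⟨c, hc⟩ := hx.exists_sub_mem m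
    exact ⟨c, Submodule.smul_mono_left le_sup_left hc⟩
  · rw [Submodule.sup_smul] at hc
    obtain ⟨a, ha, b, hb, hab⟩ := Submodule.mem_sup.1 hc
    -- An element of `J M` has an expansion modulo `I M` with coefficients in `J`; subtracting it
    -- from `c` leaves a relation modulo `I`.
    have hJ : ∃ d : ι → Λ, (∀ i, d i ∈ J) ∧ b - ∑ i, d i • x i ∈ I • (⊤ : Submodule Λ M) := by
      clear hab
      refine Submodule.smul_induction_on hb (fun r hr m _ => ?_) ?_
      · obtain ⟨e, he⟩ := hx.exists_sub_mem m
        refine ⟨fun i => r * e i, fun i => J.mul_mem_right _ hr, ?_⟩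
        have := Submodule.smul_mem _ r he
        simpa only [smul_sub, Finset.smul_sum, smul_smul] using this
      · rintro m n ⟨d, hd, hm⟩ ⟨e, he, hn⟩
        refine ⟨fun i => d i + e i, fun i => add_mem (hd i) (he i), ?_⟩
        have := add_mem hm hn
        simp only [add_smul, Finset.sum_add_distrib]
        convert this using 1
        abel
    obtain ⟨d, hd, hbd⟩ := hJ
    have h := hx.mem_of_sum_mem (fun i => c i - d i) (by
      simp only [sub_smul, Finset.sum_sub_distrib]
      rw [← hab, add_sub_assoc]
      exact add_mem ha hbd)
    intro i
    have := add_mem (Submodule.mem_sup_left (T := J) (h i)) (Submodule.mem_sup_right (S := I) (hd i))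
    simpa using this

/-- A family which is a basis modulo two ideals intersecting in `0` is a basis. -/
theorem nonempty_equiv (hI : IsBasisMod I x) (hJ : IsBasisMod J x) (h : I ⊓ J = ⊥) :
    Nonempty ((ι → Λ) ≃ₗ[Λ] M) := by
  let f : (ι → Λ) →ₗ[Λ] M := Fintype.linearCombination Λ x
  have hf : ∀ c, f c = ∑ i, c i • x i := fun c => Fintype.linearCombination_apply Λ x c
  refine ⟨LinearEquiv.ofBijective f ⟨?_, ?_⟩⟩
  · rw [injective_iff_map_eq_zero]
    intro c hc
    rw [hf] at hc
    funext i
    have : c i ∈ I ⊓ J := ⟨hI.mem_of_sum_mem c (hc ▸ zero_mem _) i,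
      hJ.mem_of_sum_mem c (hc ▸ zero_mem _) i⟩
    rw [h] at this
    exact this
  · have hsup : ∀ (K : Ideal Λ), IsBasisMod K x → ⊤ ≤ LinearMap.range f ⊔ K • ⊤ := by
      intro K hK m _
      obtain ⟨c, hc⟩ := hK.exists_sub_mem m
      exact Submodule.mem_sup.2 ⟨f c, ⟨c, rfl⟩, _, hc, by rw [hf]; abel⟩
    rw [← LinearMap.range_eq_top, eq_top_iff]
    -- If `N` is the range, then `M = N + I M = N + J M`; substituting gives `M = N + I J M = N`, as
    -- `I J ⊆ I ⊓ J = 0`. No Nakayama argument is needed.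
    have hIJ : I • J • (⊤ : Submodule Λ M) = ⊥ := by
      rw [← mul_smul]
      have : I * J = ⊥ := le_bot_iff.1 (h ▸ Ideal.mul_le_inf)
      rw [this, Submodule.bot_smul]
    calc ⊤ ≤ LinearMap.range f ⊔ I • ⊤ := hsup I hI
      _ ≤ LinearMap.range f ⊔ I • (LinearMap.range f ⊔ J • ⊤) :=
        sup_le_sup_left (Submodule.smul_mono le_rfl (hsup J hJ)) _
      _ ≤ LinearMap.range f := by
        rw [Submodule.smul_sup, hIJ, sup_bot_eq]
        exact sup_le le_rfl Submodule.smul_le_right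

/-- Bases modulo `I` and modulo `J` which agree modulo `I + J` can be glued. -/
theorem exists_glue (hI : IsBasisMod I x) (hJ : IsBasisMod J y)
    (h : ∀ i, x i - y i ∈ (I ⊔ J) • (⊤ : Submodule Λ M)) :
    ∃ z : ι → M, IsBasisMod I z ∧ IsBasisMod J z := by
  simp only [Submodule.sup_smul, Submodule.mem_sup] at h
  choose a ha b hb hab using h
  -- With `x - y = a + b`, `a` in `I M` and `b` in `J M`, the common value `x - a = y + b` works on
  -- both sides.
  refine ⟨fun i => x i - a i, hI.congr fun i => by simpa using ha i, hJ.congr fun i => ?_⟩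
  have : y i - (x i - a i) = -b i := by
    rw [sub_sub_eq_add_sub, add_comm, add_sub_assoc, ← neg_sub (x i), ← hab i]
    abel
  rw [this]
  exact neg_mem (hb i)

/-- Changing a basis modulo `I` by a matrix invertible modulo `I`. -/
theorem matrix_smul [DecidableEq ι] (hx : IsBasisMod I x) {H H' : Matrix ι ι Λ}
    (h : (H * H').map (Ideal.Quotient.mk I) = 1) (h' : (H' * H).map (Ideal.Quotient.mk I) = 1) :
    IsBasisMod I fun i => ∑ j, H i j • x j := by
  have key : ∀ (A : Matrix ι ι Λ) (c : ι → Λ), ∑ i, c i • ∑ j, A i j • x j =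
      ∑ j, (∑ i, c i * A i j) • x j := by
    intro A c
    simp only [Finset.smul_sum, smul_smul, Finset.sum_smul]
    exact Finset.sum_comm
  have mod : ∀ (A B : Matrix ι ι Λ), (A * B).map (Ideal.Quotient.mk I) = 1 → ∀ (c : ι → Λ) j,
      c j - ∑ k, (∑ i, c i * A i k) * B k j ∈ I := by
    intro A B hAB c j
    have h1 : ∑ k, (∑ i, c i * A i k) * B k j = ∑ i, c i * (A * B) i j := by
      simp only [Matrix.mul_apply, Finset.sum_mul, Finset.mul_sum, mul_assoc]
      exact Finset.sum_comm
    have h2 : ∀ i, Ideal.Quotient.mk I ((A * B) i j) = (1 : Matrix ι ι (Λ ⧸ I)) i j := fun i => by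
      rw [← hAB, Matrix.map_apply]
    rw [h1, ← Ideal.Quotient.eq_zero_iff_mem, map_sub, map_sum]
    simp [h2, Matrix.one_apply]
  refine ⟨fun m => ?_, fun c hc => ?_⟩
  · obtain ⟨c, hc⟩ := hx.exists_sub_mem m
    refine ⟨fun k => ∑ i, c i * H' i k, ?_⟩
    rw [key]
    have := sum_smul_mem I (mod H' H h' c) x
    simp only [sub_smul, Finset.sum_sub_distrib] at this
    simpa using add_mem hc this
  · rw [key] at hc
    have h1 := hx.mem_of_sum_mem _ hc
    intro i
    have h2 := add_mem (mod H H' h c i)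
      (sum_mem (t := Finset.univ) fun k _ => I.mul_mem_right (H' k i) (h1 k))
    simpa using h2

/-- The transition matrix of two bases modulo `I` is invertible modulo `I`. -/
theorem exists_transition [DecidableEq ι] (hx : IsBasisMod I x) (hy : IsBasisMod I y) :
    ∃ A : Matrix ι ι Λ, (∀ i, y i - ∑ j, A i j • x j ∈ I • (⊤ : Submodule Λ M)) ∧
      IsUnit (A.map (Ideal.Quotient.mk I)) := by
  choose A hA using fun i => hx.exists_sub_mem (y i)
  choose B hB using fun i => hy.exists_sub_mem (x i)
  refine ⟨A, hA, ?_⟩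
  have key : (Matrix.of B).map (Ideal.Quotient.mk I) * (Matrix.of A).map (Ideal.Quotient.mk I)
      = 1 := by
    ext i k
    have h1 : x i - ∑ j, (Matrix.of B * Matrix.of A) i j • x j ∈ I • (⊤ : Submodule Λ M) := by
      have h2 := add_mem (hB i) (sum_mem (t := Finset.univ) fun j _ =>
        Submodule.smul_mem _ (B i j) (hA j))
      convert h2 using 1
      simp only [smul_sub, Finset.sum_sub_distrib, Finset.smul_sum, smul_smul, Matrix.mul_apply,
        Finset.sum_smul, Matrix.of_apply]
      rw [Finset.sum_comm]
      abel
    have h3 : ∑ j, ((1 : Matrix ι ι Λ) i j - (Matrix.of B * Matrix.of A) i j) • x j ∈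
        I • (⊤ : Submodule Λ M) := by
      simpa [sub_smul, Finset.sum_sub_distrib, Matrix.one_apply] using h1
    have h4 := hx.mem_of_sum_mem _ h3 k
    rw [← Ideal.Quotient.eq_zero_iff_mem, map_sub, sub_eq_zero] at h4
    rw [← Matrix.map_mul, Matrix.map_apply, ← h4]
    simp only [Matrix.one_apply]
    split <;> simp
  -- Square matrices over a commutative ring need only a one-sided inverse.
  exact IsUnit.of_mul_eq_one_right _ key

end IsBasisMod

/-! ### Lifting invertible matrices and gluing bases -/

/-- If every nonzero element of a field `k` lifts to a unit along `f : R →+* k`, and `f` is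
surjective, then invertible matrices lift to invertible matrices. -/
theorem exists_isUnit_matrix_map_eq {R k ι : Type*} [CommRing R] [Field k] [Fintype ι]
    [DecidableEq ι] (f : R →+* k) (hf : Function.Surjective f)
    (hu : ∀ a : k, a ≠ 0 → ∃ u : R, IsUnit u ∧ f u = a) (A : Matrix ι ι k) (hA : IsUnit A) :
    ∃ H : Matrix ι ι R, IsUnit H ∧ H.map f = A := by
  refine Matrix.diagonal_transvection_induction_of_det_ne_zero
    (fun A => ∃ H : Matrix ι ι R, IsUnit H ∧ H.map f = A) A
    ((Matrix.isUnit_iff_isUnit_det A).1 hA).ne_zero (fun D hD => ?_) (fun t => ?_) ?_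
  · rw [Matrix.det_diagonal, Finset.prod_ne_zero_iff] at hD
    choose v hv hvD using fun i => hu (D i) (hD i (Finset.mem_univ i))
    refine ⟨Matrix.diagonal v, ?_, ?_⟩
    · rw [Matrix.isUnit_iff_isUnit_det, Matrix.det_diagonal]
      exact IsUnit.prod_univ_iff.2 hv
    · rw [Matrix.diagonal_map (map_zero f)]
      exact congrArg _ (funext hvD)
  · obtain ⟨c, hc⟩ := hf t.c
    refine ⟨Matrix.transvection t.i t.j c, ?_, ?_⟩
    · rw [Matrix.isUnit_iff_isUnit_det, Matrix.det_transvection_of_ne _ _ t.hij]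
      exact isUnit_one
    · rw [Matrix.TransvectionStruct.toMatrix, ← hc]
      ext i j
      simp [Matrix.transvection, Matrix.single_apply, Matrix.one_apply, apply_ite f]
  · rintro A B _ _ ⟨H, hH, rfl⟩ ⟨H', hH', rfl⟩
    exact ⟨H * H', hH.mul hH', by rw [Matrix.map_mul]⟩

/-- A module with bases modulo `I` and modulo `J` of the same cardinality is free if
`I ∩ J = 0`, `I + J` is maximal, and units lift from `Λ / (I + J)` to `Λ / I`. -/
theorem nonempty_equiv_of_isBasisMod {Λ M ι : Type*} [CommRing Λ] [AddCommGroup M] [Module Λ M]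
    [Fintype ι] {I J : Ideal Λ} (hIJ : I ⊓ J = ⊥) (hmax : (I ⊔ J).IsMaximal)
    (hu : ∀ a : Λ, a ∉ I ⊔ J → ∃ u v : Λ, u * v - 1 ∈ I ∧ u - a ∈ I ⊔ J)
    {x y : ι → M} (hx : IsBasisMod I x) (hy : IsBasisMod J y) :
    Nonempty ((ι → Λ) ≃ₗ[Λ] M) := by
  classical
  obtain ⟨A, hA, hAu⟩ := (hx.sup J).exists_transition (sup_comm J I ▸ hy.sup I)
  let _ : Field (Λ ⧸ I ⊔ J) := Ideal.Quotient.field _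
  let f : Λ ⧸ I →+* Λ ⧸ I ⊔ J := Ideal.Quotient.factor le_sup_left
  have hf : ∀ a, f (Ideal.Quotient.mk I a) = Ideal.Quotient.mk (I ⊔ J) a := fun a => rfl
  obtain ⟨H, hH, hHA⟩ := exists_isUnit_matrix_map_eq f (Ideal.Quotient.factor_surjective _)
    (fun a ha => by
      obtain ⟨a, rfl⟩ := Ideal.Quotient.mk_surjective a
      rw [Ne, Ideal.Quotient.eq_zero_iff_mem] at ha
      obtain ⟨u, v, huv, hua⟩ := hu a ha
      refine ⟨Ideal.Quotient.mk I u, ?_, ?_⟩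
      · rw [← Ideal.Quotient.eq_zero_iff_mem, map_sub, sub_eq_zero, map_mul, map_one] at huv
        exact IsUnit.of_mul_eq_one _ huv
      · rw [hf, Ideal.Quotient.mk_eq_mk_iff_sub_mem]
        exact hua) _ hAu
  have lift : ∀ B : Matrix ι ι (Λ ⧸ I), ∃ C : Matrix ι ι Λ, C.map (Ideal.Quotient.mk I) = B := by
    intro B
    choose C hC using fun i j => Ideal.Quotient.mk_surjective (B i j)
    exact ⟨Matrix.of C, by ext i j; exact hC i j⟩
  -- The lifts `C` and `C'` to `Λ` are mutually inverse only modulo `I`, which is all that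
  -- `matrix_smul` requires.
  obtain ⟨⟨H, H', h, h'⟩, rfl⟩ := hH
  obtain ⟨C, rfl⟩ := lift H
  obtain ⟨C', rfl⟩ := lift H'
  rw [← Matrix.map_mul] at h h'
  obtain ⟨z, hzI, hzJ⟩ := (hx.matrix_smul h h').exists_glue hy fun i => by
    have h1 : ∀ j, C i j - A i j ∈ I ⊔ J := fun j => by
      rw [← Ideal.Quotient.mk_eq_mk_iff_sub_mem, ← hf]
      exact congrFun (congrFun hHA i) j
    have h2 := sub_mem (IsBasisMod.sum_smul_mem (I ⊔ J) h1 x) (hA i)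
    simpa only [sub_smul, Finset.sum_sub_distrib, sub_sub_sub_cancel_right, sub_sub,
      add_sub_cancel] using h2
  exact hzI.nonempty_equiv hzJ hIJ

/-- If `Γ ⊗ M` is free and `Λ → Λ / I` factors through `Γ`, then `M` has a basis modulo `I`. -/
theorem exists_isBasisMod {Λ Γ M ι : Type*} [CommRing Λ] [CommRing Γ] [Algebra Λ Γ]
    [AddCommGroup M] [Module Λ M] [Fintype ι] (e : Γ ⊗[Λ] M ≃ₗ[Γ] (ι → Γ)) {R : Type*} [CommRing R]
    (s : Γ →+* R) (hs : Function.Surjective (s.comp (algebraMap Λ Γ))) :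
    ∃ x : ι → M, IsBasisMod (RingHom.ker (s.comp (algebraMap Λ Γ))) x := by
  classical
  set I := RingHom.ker (s.comp (algebraMap Λ Γ)) with hI
  let q := RingHom.quotientKerEquivOfSurjective hs
  -- This makes `Λ ⧸ I` a `Γ`-algebra, so that `M / I M` is a base change of the free module `Γ ⊗
  -- M`.
  let r : Γ →+* Λ ⧸ I := q.symm.toRingHom.comp s
  let _ : Algebra Γ (Λ ⧸ I) := r.toAlgebra
  have : IsScalarTower Λ Γ (Λ ⧸ I) := IsScalarTower.of_algebraMap_eq fun a => by
    change Ideal.Quotient.mk I a = q.symm (s (algebraMap Λ Γ a))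
    rw [RingEquiv.eq_symm_apply]
    exact RingHom.quotientKerEquivOfSurjective_apply_mk hs a
  let E : (Λ ⧸ I) ⊗[Λ] M ≃ₗ[Λ ⧸ I] (ι → Λ ⧸ I) :=
    (TensorProduct.AlgebraTensorModule.cancelBaseChange Λ Γ (Λ ⧸ I) (Λ ⧸ I) M).symm ≪≫ₗ
      e.baseChange Γ (Λ ⧸ I) _ _ ≪≫ₗ TensorProduct.piScalarRight Γ (Λ ⧸ I) (Λ ⧸ I) ι
  let T : M →ₗ[Λ] (ι → Λ ⧸ I) :=
    E.toLinearMap.restrictScalars Λ ∘ₗ TensorProduct.mk Λ (Λ ⧸ I) M 1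
  have hT : ∀ m, T m = E (1 ⊗ₜ m) := fun m => rfl
  have hker : ∀ m, T m = 0 ↔ m ∈ I • (⊤ : Submodule Λ M) := by
    intro m
    rw [hT, LinearEquiv.map_eq_zero_iff,
      ← (TensorProduct.quotTensorEquivQuotSMul M I).map_eq_zero_iff]
    have : TensorProduct.quotTensorEquivQuotSMul M I ((1 : Λ ⧸ I) ⊗ₜ[Λ] m) =
        Submodule.Quotient.mk m := by
      simp
    rw [this, Submodule.Quotient.mk_eq_zero]
  have hsurj : Function.Surjective T := by
    intro v
    obtain ⟨w, rfl⟩ := E.surjective v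
    obtain ⟨m, rfl⟩ := TensorProduct.mk_surjective Λ M (Λ ⧸ I) Ideal.Quotient.mk_surjective w
    exact ⟨m, rfl⟩
  choose x hx using fun i => hsurj (Pi.single i 1)
  have hsum : ∀ c : ι → Λ, T (∑ i, c i • x i) = fun i => Ideal.Quotient.mk I (c i) := by
    intro c
    funext j
    simp only [map_sum, map_smul, hx, Finset.sum_apply, Pi.smul_apply, Pi.single_apply]
    simp [Algebra.smul_def]
  refine ⟨x, fun m => ?_, fun c hc i => ?_⟩
  · choose c hc using fun i => Ideal.Quotient.mk_surjective (T m i)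
    refine ⟨c, ?_⟩
    rw [← hker, map_sub, hsum, sub_eq_zero]
    exact funext fun i => (hc i).symm
  · rw [← hker, hsum] at hc
    exact Ideal.Quotient.eq_zero_iff_mem.1 (congrFun hc i)

/-! ### The group ring of a cyclic group of prime order -/

section CyclicGroupRing

open Polynomial

variable {G : Type u} [CommGroup G] [Finite G] {K : Type*} [Field K] [CharZero K]

/-- The ring homomorphism from the maximal order of `ℚ[G]` to the ring of integers of `K` induced
by a character `G →* K`. -/
noncomputable def maximalOrderLift (χ : G →* K) : maximalOrder G →+* integralClosure ℤ K :=
  (((MonoidAlgebra.lift ℚ K G χ).toRingHom.comp (maximalOrder G).val.toRingHom)).codRestrict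
    (integralClosure ℤ K) fun x =>
      (show IsIntegral ℤ (x : MonoidAlgebra ℚ G) from x.2).map
        (MonoidAlgebra.lift ℚ K G χ).toRingHom.toIntAlgHom

/-- The ring homomorphism from `ℤ[G]` to the ring of integers of `K` induced by a character. -/
noncomputable def groupRingLift (χ : G →* K) : MonoidAlgebra ℤ G →+* integralClosure ℤ K :=
  (maximalOrderLift χ).comp (algebraMap (MonoidAlgebra ℤ G) (maximalOrder G))

/-! ### Elements of the group ring as polynomials in a generator -/

theorem coe_groupRingLift_aeval (χ : G →* K) (g : G) (f : ℤ[X]) :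
    (groupRingLift χ (aeval (MonoidAlgebra.of ℤ G g) f) : K) = aeval (χ g) f := by
  let F : MonoidAlgebra ℤ G →+* K := (integralClosure ℤ K).val.toRingHom.comp (groupRingLift χ)
  have hF : F (MonoidAlgebra.of ℤ G g) = χ g := by
    change MonoidAlgebra.lift ℚ K G χ (MonoidAlgebra.mapRingHom G (Int.castRingHom ℚ)
      (MonoidAlgebra.single g 1)) = χ g
    simp
  have h := Polynomial.map_aeval_eq_aeval_map (φ := RingHom.id ℤ) (ψ := F)
    (RingHom.ext_int _ _) f (MonoidAlgebra.of ℤ G g)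
  rw [hF, Polynomial.map_id] at h
  exact h

theorem exists_aeval_of_eq {g : G} (hg : ∀ x, x ∈ Subgroup.zpowers g) (x : MonoidAlgebra ℤ G) :
    ∃ f : ℤ[X], aeval (MonoidAlgebra.of ℤ G g) f = x := by
  induction x using MonoidAlgebra.induction_linear with
  | zero => exact ⟨0, map_zero _⟩
  | add a b ha hb =>
    obtain ⟨f, rfl⟩ := ha
    obtain ⟨f', rfl⟩ := hb
    exact ⟨f + f', map_add _ _ _⟩
  | single h r =>
    obtain ⟨k, rfl⟩ := mem_powers_iff_mem_zpowers.2 (hg h)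
    refine ⟨C r * X ^ k, ?_⟩
    rw [map_mul, map_pow, aeval_X, aeval_C, ← map_pow, MonoidAlgebra.of_apply,
      ← Algebra.smul_def, MonoidAlgebra.smul_single, smul_eq_mul, mul_one]

theorem aeval_of_eq_zero {H : Type*} [CommGroup H] {p : ℕ} {h : H} (hh : h ^ p = 1) {f : ℤ[X]}
    (hf : X ^ p - 1 ∣ f) : aeval (MonoidAlgebra.of ℤ H h) f = 0 := by
  obtain ⟨q, rfl⟩ := hf
  rw [map_mul, map_sub, map_pow, aeval_X, ← map_pow, hh, map_one, map_one, sub_self, zero_mul]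

theorem groupRingLift_surjective_of_adjoin (χ : G →* K) (g : G)
    (h : ∀ x : K, IsIntegral ℤ x → x ∈ Algebra.adjoin ℤ {χ g}) :
    Function.Surjective (groupRingLift χ) := by
  rintro ⟨x, hx⟩
  have := h x hx
  rw [Algebra.adjoin_singleton_eq_range_aeval] at this
  obtain ⟨f, rfl⟩ := this
  exact ⟨_, Subtype.ext (coe_groupRingLift_aeval χ g f)⟩

theorem isIntegral_rat_mem_adjoin (a x : ℚ) (hx : IsIntegral ℤ x) : x ∈ Algebra.adjoin ℤ {a} := by
  obtain ⟨m, rfl⟩ := IsIntegrallyClosed.isIntegral_iff.1 hx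
  exact Subalgebra.algebraMap_mem _ m

/-- The ring of integers of the cyclotomic field is `ℤ[ζ]`; this makes `ℤ[G]` surject onto it, not
merely the maximal order. -/
theorem isIntegral_mem_adjoin_of_isPrimitiveRoot {p : ℕ} [NeZero p]
    [IsCyclotomicExtension {p} ℚ K] {ζ : K} (hζ : IsPrimitiveRoot ζ p) (x : K)
    (hx : IsIntegral ℤ x) : x ∈ Algebra.adjoin ℤ {ζ} := by
  obtain ⟨y, rfl⟩ :=
    (IsCyclotomicExtension.Rat.isIntegralClosure_adjoin_singleton hζ).isIntegral_iff.1 hx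
  exact y.2

/-! ### The two kernels, their intersection and their sum -/

variable {p : ℕ} {g : G} {χ : G →* K} {ε : G →* ℚ}

/-- The `p`-th cyclotomic polynomial `Φ_p` is the minimal polynomial of `ζ` over the integrally
closed ring `ℤ`. -/
theorem aeval_mem_ker_groupRingLift_iff (hp : p.Prime) (hχ : IsPrimitiveRoot (χ g) p) (f : ℤ[X]) :
    aeval (MonoidAlgebra.of ℤ G g) f ∈ RingHom.ker (groupRingLift χ) ↔ cyclotomic p ℤ ∣ f := by
  rw [RingHom.mem_ker, ← ZeroMemClass.coe_eq_zero, coe_groupRingLift_aeval,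
    cyclotomic_eq_minpoly hχ hp.pos, minpoly.isIntegrallyClosed_dvd_iff (hχ.isIntegral hp.pos)]

theorem aeval_mem_ker_groupRingLift_iff_eval (hε : ε g = 1) (f : ℤ[X]) :
    aeval (MonoidAlgebra.of ℤ G g) f ∈ RingHom.ker (groupRingLift ε) ↔ f.eval 1 = 0 := by
  rw [RingHom.mem_ker, ← ZeroMemClass.coe_eq_zero, coe_groupRingLift_aeval, hε]
  have : aeval (1 : ℚ) f = ((f.eval 1 : ℤ) : ℚ) := by
    simpa using aeval_algebraMap_apply ℚ (1 : ℤ) f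
  rw [this, Int.cast_eq_zero]

/-- If `f = Φ_p q` and `f(1) = p q(1) = 0`, then `X - 1` divides `q`, so `X ^ p - 1 = Φ_p (X - 1)`
divides `f`. -/
theorem ker_groupRingLift_inf_eq_bot (hp : p.Prime) (hg : ∀ x, x ∈ Subgroup.zpowers g)
    (hgp : g ^ p = 1) (hχ : IsPrimitiveRoot (χ g) p) (hε : ε g = 1) :
    RingHom.ker (groupRingLift χ) ⊓ RingHom.ker (groupRingLift ε) = ⊥ := by
  rw [eq_bot_iff]
  rintro x ⟨hx, hx'⟩
  obtain ⟨f, rfl⟩ := exists_aeval_of_eq hg x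
  have : Fact p.Prime := ⟨hp⟩
  obtain ⟨q, rfl⟩ := (aeval_mem_ker_groupRingLift_iff hp hχ f).1 hx
  have h := (aeval_mem_ker_groupRingLift_iff_eval hε _).1 hx'
  rw [eval_mul, eval_one_cyclotomic_prime, mul_eq_zero_iff_left (by exact_mod_cast hp.ne_zero)] at h
  refine aeval_of_eq_zero hgp ?_
  rw [← cyclotomic_prime_mul_X_sub_one ℤ p]
  exact mul_dvd_mul_left _ (by simpa using dvd_iff_isRoot.2 h)

/-- The kernel of `χ` is generated by `Φ_p(g)`, whose augmentation is `Φ_p(1) = p`. Hence the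
quotient by the sum is evaluation at `1` modulo `p`. -/
theorem aeval_mem_sup_iff (hp : p.Prime) (hg : ∀ x, x ∈ Subgroup.zpowers g)
    (hχ : IsPrimitiveRoot (χ g) p) (hε : ε g = 1) (f : ℤ[X]) :
    aeval (MonoidAlgebra.of ℤ G g) f ∈
      RingHom.ker (groupRingLift χ) ⊔ RingHom.ker (groupRingLift ε) ↔ (p : ℤ) ∣ f.eval 1 := by
  have : Fact p.Prime := ⟨hp⟩
  constructor
  · intro h
    obtain ⟨a, ha, b, hb, hab⟩ := Submodule.mem_sup.1 h
    obtain ⟨a, rfl⟩ := exists_aeval_of_eq hg a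
    obtain ⟨q, rfl⟩ := (aeval_mem_ker_groupRingLift_iff hp hχ a).1 ha
    have hb' : aeval (MonoidAlgebra.of ℤ G g) (f - cyclotomic p ℤ * q) ∈
        RingHom.ker (groupRingLift ε) := by
      rw [map_sub, ← hab, add_sub_cancel_left]
      exact hb
    rw [aeval_mem_ker_groupRingLift_iff_eval hε, eval_sub, eval_mul, eval_one_cyclotomic_prime,
      sub_eq_zero] at hb'
    exact ⟨_, hb'⟩
  · rintro ⟨c, hc⟩
    refine Submodule.mem_sup.2 ⟨aeval (MonoidAlgebra.of ℤ G g) (cyclotomic p ℤ * C c),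
      (aeval_mem_ker_groupRingLift_iff hp hχ _).2 (dvd_mul_right _ _),
      aeval (MonoidAlgebra.of ℤ G g) (f - cyclotomic p ℤ * C c),
      (aeval_mem_ker_groupRingLift_iff_eval hε _).2 ?_, ?_⟩
    · simp [hc, eval_one_cyclotomic_prime]
    · simp

theorem ker_groupRingLift_sup_isMaximal (hp : p.Prime) (hg : ∀ x, x ∈ Subgroup.zpowers g)
    (hχ : IsPrimitiveRoot (χ g) p) (hε : ε g = 1) :
    (RingHom.ker (groupRingLift χ) ⊔ RingHom.ker (groupRingLift ε)).IsMaximal := by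
  have key := aeval_mem_sup_iff hp hg hχ hε
  refine Ideal.isMaximal_iff.2 ⟨fun h => ?_, fun N x hN hx hxN => ?_⟩
  · have := (key 1).1 (by rwa [map_one])
    rw [eval_one] at this
    exact (Nat.prime_iff_prime_int.1 hp).not_dvd_one this
  · obtain ⟨f, rfl⟩ := exists_aeval_of_eq hg x
    rw [key] at hx
    -- Bézout: `a p + b f(1) = 1`, so `1 - b f` takes the value `a p` at `1` and lies in the sum.
    obtain ⟨a, b, hab⟩ := (Nat.prime_iff_prime_int.1 hp).irreducible.coprime_iff_not_dvd.2 hx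
    have h1 : aeval (MonoidAlgebra.of ℤ G g) (1 - C b * f) ∈ N :=
      hN ((key _).2 ⟨a, by simp; linarith⟩)
    have h2 := add_mem h1 (N.mul_mem_left (aeval (MonoidAlgebra.of ℤ G g) (C b)) hxN)
    simpa using h2

/-- The units `1 + ζ + ⋯ + ζ ^ (k - 1)` represent all the nonzero residue classes. -/
theorem exists_unit_lift (hp : p.Prime) (hg : ∀ x, x ∈ Subgroup.zpowers g)
    (hχ : IsPrimitiveRoot (χ g) p) (hε : ε g = 1) (a : MonoidAlgebra ℤ G)
    (ha : a ∉ RingHom.ker (groupRingLift χ) ⊔ RingHom.ker (groupRingLift ε)) :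
    ∃ u v : MonoidAlgebra ℤ G, u * v - 1 ∈ RingHom.ker (groupRingLift χ) ∧
      u - a ∈ RingHom.ker (groupRingLift χ) ⊔ RingHom.ker (groupRingLift ε) := by
  have : Fact p.Prime := ⟨hp⟩
  obtain ⟨f, rfl⟩ := exists_aeval_of_eq hg a
  rw [aeval_mem_sup_iff hp hg hχ hε] at ha
  set c : ZMod p := ((f.eval 1 : ℤ) : ZMod p) with hc
  have hc0 : c ≠ 0 := by rwa [Ne, hc, ZMod.intCast_zmod_eq_zero_iff_dvd]
  set k := c.val with hk
  set j := c⁻¹.val with hj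
  have hkj : k * j ≡ 1 [MOD p] := by
    rw [← ZMod.natCast_eq_natCast_iff]
    simp [k, j, hc0]
  -- Here `P(1) = k` is the prescribed residue, and `Q(ζ)` inverts `P(ζ)`: with `j` inverse to `k`
  -- modulo `p`, the product telescopes to `P(ζ) Q(ζ) (ζ - 1) = ζ ^ (k j) - 1 = ζ - 1`.
  let P : ℤ[X] := ∑ i ∈ Finset.range k, X ^ i
  let Q : ℤ[X] := ∑ i ∈ Finset.range j, (X ^ k) ^ i
  refine ⟨aeval (MonoidAlgebra.of ℤ G g) P, aeval (MonoidAlgebra.of ℤ G g) Q, ?_, ?_⟩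
  · rw [← map_mul, ← map_one (aeval (R := ℤ) (MonoidAlgebra.of ℤ G g)), ← map_sub,
      aeval_mem_ker_groupRingLift_iff hp hχ]
    rw [cyclotomic_eq_minpoly hχ hp.pos, ← minpoly.isIntegrallyClosed_dvd_iff (hχ.isIntegral hp.pos)]
    have h1 : χ g - 1 ≠ 0 := sub_ne_zero.2 (hχ.ne_one hp.one_lt)
    refine mul_right_cancel₀ h1 ?_
    simp only [P, Q, map_sub, map_mul, map_sum, map_pow, aeval_X, map_one]
    rw [zero_mul, sub_mul, mul_right_comm, geom_sum_mul, mul_comm (χ g ^ k - 1), geom_sum_mul,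
      one_mul, ← pow_mul, sub_sub_sub_cancel_right, sub_eq_zero]
    conv_rhs => rw [← pow_one (χ g)]
    exact pow_eq_pow_of_modEq hkj hχ.pow_eq_one
  · rw [← map_sub, aeval_mem_sup_iff hp hg hχ hε, ← ZMod.intCast_zmod_eq_zero_iff_dvd]
    simp [P, eval_finsetSum, hk, hc]

end CyclicGroupRing

/-! ### Descent of freeness from the maximal order -/

/-- A module over the group ring of a group of prime order which becomes free over the
maximal order is free. -/
theorem nonempty_equiv_of_baseChange_maximalOrder {p : ℕ} (hp : p.Prime) {G : Type u} [CommGroup G]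
    [Finite G] (hG : Nonempty (G ≃* Multiplicative (ZMod p))) {M ι : Type*} [AddCommGroup M]
    [Module (MonoidAlgebra ℤ G) M] [Fintype ι]
    (K : Type*) [Field K] [CharZero K] [IsCyclotomicExtension {p} ℚ K]
    (e : maximalOrder G ⊗[MonoidAlgebra ℤ G] M ≃ₗ[maximalOrder G] (ι → maximalOrder G)) :
    Nonempty ((ι → MonoidAlgebra ℤ G) ≃ₗ[MonoidAlgebra ℤ G] M) := by
  have : Fact p.Prime := ⟨hp⟩
  obtain ⟨E⟩ := hG
  have hcard : Nat.card G = p := by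
    rw [Nat.card_congr E.toEquiv]
    exact Nat.card_zmod p
  have : IsCyclic G := isCyclic_of_prime_card hcard
  obtain ⟨g, hg⟩ := IsCyclic.exists_generator (α := G)
  have hgp : orderOf g = p := by rw [orderOf_eq_card_of_forall_mem_zpowers hg, hcard]
  have hζ := IsCyclotomicExtension.zeta_spec p ℚ K
  -- Extending `g ↦ ζ` to a character of the cyclic group requires a target that is a group, hence
  -- the passage to units.
  let z : Kˣ := (hζ.isUnit hp.ne_zero).unit
  have hz : orderOf z ∣ orderOf g := by
    rw [hgp, orderOf_dvd_iff_pow_eq_one, Units.ext_iff]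
    exact hζ.pow_eq_one
  let χ : G →* K := (Units.coeHom K).comp (monoidHomOfForallMemZpowers hg hz)
  have hχ : IsPrimitiveRoot (χ g) p := by
    have h : χ g = z := congrArg Units.val (monoidHomOfForallMemZpowers_apply_gen hg hz)
    rwa [h]
  let ε : G →* ℚ := 1
  obtain ⟨x, hx⟩ := exists_isBasisMod e (maximalOrderLift χ)
    (groupRingLift_surjective_of_adjoin χ g (isIntegral_mem_adjoin_of_isPrimitiveRoot hχ))
  obtain ⟨y, hy⟩ := exists_isBasisMod e (maximalOrderLift ε)
    (groupRingLift_surjective_of_adjoin ε g (isIntegral_rat_mem_adjoin _))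
  exact nonempty_equiv_of_isBasisMod
    (ker_groupRingLift_inf_eq_bot hp hg (hgp ▸ pow_orderOf_eq_one g) hχ rfl)
    (ker_groupRingLift_sup_isMaximal hp hg hχ rfl) (exists_unit_lift hp hg hχ rfl) hx hy

theorem corollary2p2 (p : ℕ) (hp : p.Prime) (hodd : Odd p) (G : Type*) [CommGroup G] [Finite G]
    (hG : Nonempty (G ≃* Multiplicative (ZMod p))) : kernelGroup G = ⊥ := by
  have : NeZero p := ⟨hp.ne_zero⟩
  have : IsCyclotomicExtension {p} ℚ (CyclotomicField p ℚ) := by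
    -- The cyclotomic field carries two `ℚ`-algebra instances; they agree because such a structure
    -- is unique.
    rw [Subsingleton.elim (DivisionRing.toRatAlgebra : Algebra ℚ (CyclotomicField p ℚ))
      (CyclotomicField.algebra p ℚ)]
    exact CyclotomicField.isCyclotomicExtension p ℚ
  rw [eq_bot_iff]
  intro c hc
  induction c using Quotient.inductionOn with
  | _ M =>
    have hc' : LocallyFreeClassGroup.mk (M.baseChange (maximalOrder G)) = 0 := hc
    rw [LocallyFreeClassGroup.zero_def, LocallyFreeClassGroup.mk_eq_mk_iff] at hc'
    obtain ⟨a, b, ⟨e⟩⟩ := hc'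
    -- Triviality of the class gives `Γ ⊗ M ⊕ Γ^a ≅ Γ^0 ⊕ Γ^b` over the maximal order `Γ`. The left
    -- side is the base change of `M ⊕ ℤ[G]^a`, which is therefore free of rank `0 + b`, so the same
    -- `a` and `b` witness stable triviality over `ℤ[G]`.
    obtain ⟨f⟩ := nonempty_equiv_of_baseChange_maximalOrder hp hG (CyclotomicField p ℚ)
      (TensorProduct.prodRight (MonoidAlgebra ℤ G) (maximalOrder G) (maximalOrder G) M.carrier
          (Fin a → MonoidAlgebra ℤ G) ≪≫ₗ
        (LinearEquiv.refl _ _).prodCongr (TensorProduct.piScalarRight _ _ _ (Fin a)) ≪≫ₗ e ≪≫ₗ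
        finProdEquiv (maximalOrder G) 0 b)
    change LocallyFreeClassGroup.mk M = LocallyFreeClassGroup.mk _
    rw [LocallyFreeClassGroup.mk_eq_mk_iff]
    exact ⟨a, b, ⟨f.symm ≪≫ₗ (finProdEquiv _ 0 b).symm⟩⟩
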